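/- Fix $\alpha\in(0,1)$ and an integer $m\ge 0$. Let $a_0,\dots,a_m,b_0,\dots,b_m\in\mathbb{R}$ be such that $\sum_{i=0}^m b_i x^i\neq 0$ for all $x\in[0,1]$ and the rational function $$\frac{\sum_{i=0}^m a_i x^i}{\sum_{i=0}^m b_i x^i}$$ is a best approximation of $x^\alpha$ on $[0,1]$ in the supremum norm among all rational functions whose numerator and denominator are real polynomials of degree at most $m$ and whose denominator has no zero on $[0,1]$. Put $P_m(x)=\sum_{i=0}^m a_i x^{m-i}$ and $Q_m(x)=\sum_{i=0}^m b_i x^{m-i}$. Then there are a real number $k>0$, real numbers $c_1,\dots,c_m>0$ and pairwise distinct real numbers $p_1,\dots,p_m<0$ such that the real zeros of $Q_m$ are exactly $p_1,\dots,p_m$, and $$\frac{P_m(x)}{Q_m(x)} = k+\sum_{i=1}^m\frac{c_i}{x-p_i}\qquad\text{for all real } x\notin\{p_1,\dots,p_m\}.$$ -/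

import Mathlib

noncomputable section

/-- The real polynomial function `x ↦ ∑_{i=0}^m a_i x^i` with coefficients `a_0, …, a_m`. -/
def polyFun {m : ℕ} (a : Fin (m + 1) → ℝ) (x : ℝ) : ℝ :=
  ∑ i : Fin (m + 1), a i * x ^ (i : ℕ)

/-- The polynomial function `x ↦ ∑_{i=0}^m a_i x^{m-i}`, with the order of the coefficients
reversed (`i ≤ m`, so the subtraction of natural numbers is exact). -/
def revPolyFun {m : ℕ} (a : Fin (m + 1) → ℝ) (x : ℝ) : ℝ :=
  ∑ i : Fin (m + 1), a i * x ^ (m - (i : ℕ))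

/-- The denominator with coefficients `b` has no zero on `[0,1]`, so that dividing by it gives
a rational function that is finite (hence continuous) on `[0,1]`. -/
def DenomAdmissible {m : ℕ} (b : Fin (m + 1) → ℝ) : Prop :=
  ∀ x ∈ Set.Icc (0 : ℝ) 1, polyFun b x ≠ 0

/-- The supremum norm on `[0,1]` of `f - p / q`, where `p` and `q` are the polynomials with
coefficients `a` and `b`. It is used only for admissible `b` and `f` continuous on `[0,1]`, so
that the supremum is that of a bounded function. -/
def uniformError {m : ℕ} (f : ℝ → ℝ) (a b : Fin (m + 1) → ℝ) : ℝ :=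
  ⨆ x : Set.Icc (0 : ℝ) 1, |f x - polyFun a x / polyFun b x|

/-- `(∑ a_i x^i) / (∑ b_i x^i)` is a best approximation of `f` with respect to the supremum norm
on `[0,1]`, among the rational functions whose numerator and denominator have degree at most `m`. -/
def IsBestRationalApprox {m : ℕ} (f : ℝ → ℝ) (a b : Fin (m + 1) → ℝ) : Prop :=
  DenomAdmissible b ∧
    ∀ a' b' : Fin (m + 1) → ℝ, DenomAdmissible b' → uniformError f a b ≤ uniformError f a' b'

end

open Polynomial MeasureTheory

/-! Up to a positive constant, `x ^ (α - 1)` is the Stieltjes integral of `t ^ (α - 1) / (t + x)`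
over `t > 0`. Divided differences of a polynomial multiple of it are therefore integrals against a
positive weight (`sum_nodalWeight_mul_rpow_pos`).

If the error of `p / q` had too few zeros, a polynomial `φ` with the sign pattern of the error could
be written `u q - v p`, and `(p + ε u) / (q + ε v)` would be a better approximation
(`IsBestRationalApprox.exists_zeros`). So `p / q` interpolates `x ^ α` at many positive nodes, and
`q (-t)` is orthogonal to low degrees for the weight `t ^ α / ∏ (t + z)`
(`eq_zero_of_interpolates_rpow`). Orthogonality of `q` to itself rules out degeneracy, leaving `2 m
+ 1` nodes.

As for orthogonal polynomials, the denominator then has `m` distinct negative zeros. The same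
positivity with squares as test polynomials gives the sign of the residues and of the value at `0`
(`sign_of_interpolates_rpow`). Substituting `1 / x` and expanding in partial fractions concludes. -/

/-! ### Divided differences and the Stieltjes integral -/

theorem sum_nodalWeight_mul_eval_div_sub {Z : Finset ℝ} {G : ℝ[X]} (hG : G.degree < Z.card)
    {y : ℝ} (hy : ∀ z ∈ Z, y ≠ z) :
    ∑ z ∈ Z, Lagrange.nodalWeight Z id z * (G.eval z / (y - z)) =
      G.eval y / ∏ z ∈ Z, (y - z) := by
  have h1 := congrArg (Polynomial.eval y) (Lagrange.eq_interpolate (v := id) (s := Z)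
    Function.injective_id.injOn hG)
  rw [Lagrange.eval_interpolate_not_at_node (v := id) _ hy, Lagrange.eval_nodal] at h1
  simp only [id] at h1
  have h2 : ∏ z ∈ Z, (y - z) ≠ 0 := Finset.prod_ne_zero_iff.2 fun z hz => sub_ne_zero.2 (hy z hz)
  rw [eq_div_iff h2, h1, mul_comm]
  congr 1
  refine Finset.sum_congr rfl fun z _ => ?_
  rw [div_eq_mul_inv]
  ring

/-- Partial fractions of `X * G` over the nodes, evaluated at `0`; positivity of the nodes only
serves to keep `0` off them. -/
theorem sum_nodalWeight_mul_eval_eq_zero {Z : Finset ℝ} (hZ : ∀ z ∈ Z, 0 < z) {G : ℝ[X]}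
    (hG : G.degree + 1 < Z.card) : ∑ z ∈ Z, Lagrange.nodalWeight Z id z * G.eval z = 0 := by
  have h := sum_nodalWeight_mul_eval_div_sub (Z := Z) (G := X * G) (y := 0)
    (by rwa [degree_mul, degree_X, add_comm]) (fun z hz => (hZ z hz).ne)
  simp only [eval_mul, eval_X, zero_mul, zero_div] at h
  rw [← neg_eq_zero, ← h, ← Finset.sum_neg_distrib]
  refine Finset.sum_congr rfl fun z hz => ?_
  have := (hZ z hz).ne'
  field_simp
  ring

/-- A divided difference of `H x * x ^ (α - 1)` at positive nodes is, up to sign, the integral of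
`H (-t)` against a positive weight on `(0, ∞)`. -/
theorem sum_nodalWeight_mul_rpow_pos {α : ℝ} (hα : α ∈ Set.Ioo (0 : ℝ) 1) {Z : Finset ℝ}
    (hZ : ∀ z ∈ Z, 0 < z) {H : ℝ[X]} (hH : H.degree < Z.card) (hH0 : H ≠ 0)
    (hpos : ∀ t > 0, 0 ≤ H.eval (-t)) :
    0 < (-1) ^ (Z.card + 1) *
      ∑ z ∈ Z, Lagrange.nodalWeight Z id z * (H.eval z * z ^ (α - 1)) := by
  set I := ∫ t in Set.Ioi 0, Real.rpowIntegrand₀₁ α t 1 with hI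
  have hIpos : 0 < I := Real.integral_rpowIntegrand₀₁_one_pos hα
  set g : ℝ → ℝ := fun t => (-1) ^ (Z.card + 1) * ∑ z ∈ Z,
    Lagrange.nodalWeight Z id z * (H.eval z * (z⁻¹ * Real.rpowIntegrand₀₁ α t z)) with hg
  have hgi : IntegrableOn g (Set.Ioi 0) := by
    refine Integrable.const_mul (integrable_finsetSum _ fun z hz => ?_) _
    exact (((Real.integrableOn_rpowIntegrand₀₁_Ioi hα (hZ z hz).le).const_mul _).const_mul
      _).const_mul _
  have hint : ∫ t in Set.Ioi 0, g t = ((-1) ^ (Z.card + 1) *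
      ∑ z ∈ Z, Lagrange.nodalWeight Z id z * (H.eval z * z ^ (α - 1))) * I := by
    rw [hg, integral_const_mul, integral_finsetSum, mul_assoc, Finset.sum_mul]
    · congr 1
      refine Finset.sum_congr rfl fun z hz => ?_
      rw [integral_const_mul, integral_const_mul, integral_const_mul,
        Real.integral_rpowIntegrand₀₁_eq_rpow_mul_const hα (hZ z hz).le,
        Real.rpow_sub_one (hZ z hz).ne']
      ring
    · intro z hz
      exact ((Real.integrableOn_rpowIntegrand₀₁_Ioi hα (hZ z hz).le).const_mul _).const_mul _
        |>.const_mul _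
  -- Partial fractions at `y = -t`. The product contributes `Z.card` signs and `-t - z = -(t + z)`
  -- one more, whence the exponent `Z.card + 1`.
  have hgt : ∀ t > 0, g t = t ^ (α - 1) * H.eval (-t) / ∏ z ∈ Z, (t + z) := by
    intro t ht
    have h := sum_nodalWeight_mul_eval_div_sub hH (y := -t)
      (fun z hz => by have := hZ z hz; intro h; linarith)
    have hp : ∏ z ∈ Z, (-t - z) = (-1) ^ Z.card * ∏ z ∈ Z, (t + z) := by
      rw [← Finset.prod_const, ← Finset.prod_mul_distrib]
      exact Finset.prod_congr rfl fun z _ => by ring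
    have hsum : ∑ z ∈ Z, Lagrange.nodalWeight Z id z *
        (H.eval z * (z⁻¹ * Real.rpowIntegrand₀₁ α t z)) = -(t ^ (α - 1)) *
        ∑ z ∈ Z, Lagrange.nodalWeight Z id z * (H.eval z / (-t - z)) := by
      rw [Finset.mul_sum]
      refine Finset.sum_congr rfl fun z hz => ?_
      have hz0 := hZ z hz
      rw [Real.rpowIntegrand₀₁_eq_pow_div hα ht.le hz0.le,
        show -t - z = -(t + z) by ring]
      have : t + z ≠ 0 := by positivity
      field_simp
    have hs : ((-1 : ℝ) ^ Z.card) * (-1) ^ Z.card = 1 := by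
      rw [← mul_pow]; simp
    have hs' : ((-1 : ℝ) ^ Z.card) ≠ 0 := by simp
    have hpne : ∏ z ∈ Z, (t + z) ≠ 0 :=
      (Finset.prod_pos fun z hz => add_pos ht (hZ z hz)).ne'
    rw [hg]
    simp only
    rw [hsum, h, hp, pow_succ]
    field_simp
  have hgpos : 0 < ∫ t in Set.Ioi 0, g t := by
    rw [setIntegral_pos_iff_support_of_nonneg_ae _ hgi]
    · have hsub : Set.Ioi (0 : ℝ) \ (((H.comp (-X)).roots.toFinset : Finset ℝ) : Set ℝ) ⊆
          Function.support g ∩ Set.Ioi 0 := by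
        rintro t ⟨ht, htr⟩
        refine ⟨?_, ht⟩
        have hc : H.comp (-X) ≠ 0 := by
          rw [Ne, comp_neg_X_eq_zero_iff]
          exact hH0
        have hne : H.eval (-t) ≠ 0 := by
          intro h
          refine htr ?_
          rw [Finset.mem_coe, Multiset.mem_toFinset, mem_roots hc, IsRoot.def]
          simpa using h
        have ht0 : (0 : ℝ) < t := ht
        rw [Function.mem_support, hgt t ht0]
        exact div_ne_zero (mul_ne_zero (Real.rpow_pos_of_pos ht0 _).ne' hne)
          (Finset.prod_pos fun z hz => add_pos ht0 (hZ z hz)).ne'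
      refine lt_of_lt_of_le ?_ (measure_mono hsub)
      rw [measure_sdiff_null (Finset.measure_zero _ _)]
      simp
    · refine ae_restrict_of_forall_mem measurableSet_Ioi fun t ht => ?_
      have ht0 : (0 : ℝ) < t := ht
      rw [hgt t ht0]
      exact div_nonneg (mul_nonneg (Real.rpow_nonneg ht0.le _) (hpos t ht0))
        (Finset.prod_nonneg fun z hz => (add_pos ht0 (hZ z hz)).le)
  rw [hint] at hgpos
  exact pos_of_mul_pos_left hgpos hIpos.le

/-! ### Matching signs by polynomials, and a Bézout equation with degree bounds -/

theorem IsPreconnected.nonneg_or_nonpos {J : Set ℝ} (hJ : IsPreconnected J) {g : ℝ → ℝ}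
    (hg : ContinuousOn g J) (h0 : ∀ x ∈ J, g x ≠ 0) :
    (∀ x ∈ J, 0 ≤ g x) ∨ (∀ x ∈ J, g x ≤ 0) := by
  by_contra! h
  obtain ⟨⟨x, hx, hgx⟩, ⟨y, hy, hgy⟩⟩ := h
  obtain ⟨z, hz, hz0⟩ := hJ.intermediate_value hx hy hg ⟨hgx.le, hgy.le⟩
  exact h0 z hz hz0

/-- A continuous function whose zeros lie in a finite set has the same sign as some polynomial
with zeros in that set. -/
theorem exists_polynomial_mul_nonneg (Z : Finset ℝ) : ∀ (I : Set ℝ), I.OrdConnected →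
    ∀ e : ℝ → ℝ, ContinuousOn e I → (∀ x ∈ I, e x = 0 → x ∈ Z) → (∀ z ∈ Z, e z = 0) →
    ∃ φ : ℝ[X], φ.natDegree ≤ Z.card ∧ (∀ x, φ.eval x = 0 → x ∈ Z) ∧
      ∀ x ∈ I, 0 ≤ e x * φ.eval x := by
  induction Z using Finset.induction_on_max with
  | empty =>
    intro I hI e he hz hZ
    rcases hI.isPreconnected.nonneg_or_nonpos he (fun x hx h => by simpa using hz x hx h)
      with h | h
    · exact ⟨1, by simp, by simp, fun x hx => by simpa using h x hx⟩
    · exact ⟨-1, by simp, by simp, fun x hx => by simpa using h x hx⟩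
  | insert ζ Z hmax ih =>
    intro I hI e he hz hZ
    have hζ : ζ ∉ Z := fun h => lt_irrefl _ (hmax ζ h)
    obtain ⟨φ, hdeg, hroots, hsign⟩ := ih (I ∩ Set.Iio ζ) (hI.inter Set.ordConnected_Iio) e
      (he.mono Set.inter_subset_left) (fun x hx h => by
        rcases Finset.mem_insert.1 (hz x hx.1 h) with h | h
        · exact absurd h (ne_of_lt hx.2)
        · exact h) (fun z hz => hZ z (Finset.mem_insert_of_mem hz))
    have hφr : ∀ x, ζ ≤ x → φ.eval x ≠ 0 := fun x hx h =>
      absurd (hmax x (hroots x h)) (not_lt.2 hx)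
    have heζ : e ζ = 0 := hZ ζ (Finset.mem_insert_self _ _)
    rw [Finset.card_insert_of_notMem hζ]
    -- To the right of the largest zero `ζ`, `e φ` has one sign. If it is the wrong one, the factor
    -- `ζ - X`, positive on the left, corrects it.
    rcases (hI.inter Set.ordConnected_Ioi : (I ∩ Set.Ioi ζ).OrdConnected).isPreconnected
      |>.nonneg_or_nonpos (g := fun x => e x * φ.eval x)
      ((he.mono Set.inter_subset_left).mul φ.continuous.continuousOn) (fun x hx => by
        refine mul_ne_zero (fun h => ?_) (hφr x (le_of_lt hx.2))
        have hx2 : ζ < x := hx.2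
        rcases Finset.mem_insert.1 (hz x hx.1 h) with h | h
        · exact hx2.ne' h
        · exact lt_asymm hx2 (hmax x h)) with h | h
    · refine ⟨φ, by lia, fun x hx => Finset.mem_insert_of_mem (hroots x hx), fun x hx => ?_⟩
      rcases lt_trichotomy x ζ with hlt | rfl | hlt
      · exact hsign x ⟨hx, hlt⟩
      · simp [heζ]
      · exact h x ⟨hx, hlt⟩
    · refine ⟨φ * (C ζ - X), natDegree_mul_le.trans ?_, fun x hx => ?_, fun x hx => ?_⟩
      · have : (C ζ - X : ℝ[X]).natDegree ≤ 1 := by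
          refine (natDegree_sub_le _ _).trans ?_
          simp
        lia
      · rw [eval_mul, mul_eq_zero] at hx
        rcases hx with hx | hx
        · exact Finset.mem_insert_of_mem (hroots x hx)
        · rw [eval_sub, eval_C, eval_X, sub_eq_zero] at hx
          exact hx ▸ Finset.mem_insert_self _ _
      · rw [eval_mul, eval_sub, eval_C, eval_X, ← mul_assoc]
        rcases lt_trichotomy x ζ with hlt | rfl | hlt
        · exact mul_nonneg (hsign x ⟨hx, hlt⟩) (sub_nonneg.2 hlt.le)
        · simp
        · exact mul_nonneg_of_nonpos_of_nonpos (h x ⟨hx, hlt⟩) (sub_nonpos.2 hlt.le)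

/-- A Bézout solution with `v` reduced modulo `q`; the degree of `u` is then forced by `u q = φ + v
p`. -/
theorem IsCoprime.exists_mul_sub_mul_eq_aux {p q φ : ℝ[X]} (hpq : IsCoprime p q) (hq : q ≠ 0)
    {m : ℕ} (hp : p.natDegree ≤ q.natDegree) (hm : q.natDegree ≤ m)
    (hφ : φ.natDegree ≤ m + q.natDegree) :
    ∃ u v : ℝ[X], u.natDegree ≤ m ∧ v.natDegree ≤ m ∧ u * q - v * p = φ := by
  obtain ⟨s, t, hst⟩ := hpq
  set v₀ := -(s * φ) with hv₀
  have hv : (v₀ % q).natDegree ≤ q.natDegree :=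
    natDegree_le_natDegree (EuclideanDomain.mod_lt v₀ hq).le
  have hdiv := EuclideanDomain.div_add_mod v₀ q
  have heq : (t * φ - p * (v₀ / q)) * q - v₀ % q * p = φ := by
    have : v₀ % q = v₀ - q * (v₀ / q) := eq_sub_of_add_eq' hdiv
    rw [this, hv₀]
    linear_combination φ * hst
  refine ⟨t * φ - p * (v₀ / q), v₀ % q, ?_, hv.trans hm, heq⟩
  by_cases hu : t * φ - p * (v₀ / q) = 0
  · simp [hu]
  · have h1 := natDegree_mul hu hq
    have h2 : (t * φ - p * (v₀ / q)) * q = φ + v₀ % q * p := by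
      linear_combination heq
    have h3 : (φ + v₀ % q * p).natDegree ≤ m + q.natDegree :=
      (natDegree_add_le _ _).trans (max_le hφ (natDegree_mul_le.trans (by lia)))
    rw [h2] at h1
    lia

/-- The linear map `(u, v) ↦ u q - v p` on pairs of polynomials of degree at most `m` is onto the
polynomials of degree at most `m + max (deg p) (deg q)`. -/
theorem IsCoprime.exists_mul_sub_mul_eq {p q φ : ℝ[X]} (hpq : IsCoprime p q)
    {m : ℕ} (hm : max p.natDegree q.natDegree ≤ m)
    (hφ : φ.natDegree ≤ m + max p.natDegree q.natDegree) :
    ∃ u v : ℝ[X], u.natDegree ≤ m ∧ v.natDegree ≤ m ∧ u * q - v * p = φ := by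
  have swap : ∀ {p q : ℝ[X]}, IsCoprime p q → q ≠ 0 → max p.natDegree q.natDegree ≤ m →
      φ.natDegree ≤ m + max p.natDegree q.natDegree → p.natDegree ≤ q.natDegree →
      ∃ u v : ℝ[X], u.natDegree ≤ m ∧ v.natDegree ≤ m ∧ u * q - v * p = φ :=
    fun h hq h1 h2 h3 => h.exists_mul_sub_mul_eq_aux hq h3 (by lia) (by lia)
  by_cases hq : q ≠ 0 ∧ p.natDegree ≤ q.natDegree
  · exact swap hpq hq.1 hm hφ hq.2
  · have hp : p ≠ 0 := by
      rintro rfl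
      refine hq ⟨?_, by simp⟩
      rintro rfl
      exact not_isCoprime_zero_zero hpq
    have hle : q.natDegree ≤ p.natDegree := by
      by_cases h0 : q = 0
      · simp [h0]
      · have : ¬ p.natDegree ≤ q.natDegree := fun h => hq ⟨h0, h⟩
        lia
    obtain ⟨u, v, hu, hv, huv⟩ := swap hpq.symm hp (by rwa [max_comm])
      (by rwa [max_comm q.natDegree]) hle
    exact ⟨-v, -u, by rwa [natDegree_neg], by rwa [natDegree_neg], by rw [← huv]; ring⟩

/-! ### Zeros of the error of a best approximation -/

theorem polyFun_coeff {m : ℕ} {p : ℝ[X]} (hp : p.natDegree ≤ m) (x : ℝ) :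
    polyFun (fun i : Fin (m + 1) => p.coeff i) x = p.eval x := by
  rw [polyFun, eval_eq_sum_range' (Nat.lt_succ_of_le hp),
    Fin.sum_univ_eq_sum_range (fun i => p.coeff i * x ^ i)]

theorem continuous_polyFun {m : ℕ} (a : Fin (m + 1) → ℝ) : Continuous (polyFun a) := by
  unfold polyFun
  fun_prop

theorem continuousOn_sub_polyFun_div {f : ℝ → ℝ} (hf : ContinuousOn f (Set.Icc 0 1)) {m : ℕ}
    (a : Fin (m + 1) → ℝ) {b : Fin (m + 1) → ℝ} (hb : DenomAdmissible b) :
    ContinuousOn (fun x => |f x - polyFun a x / polyFun b x|) (Set.Icc 0 1) :=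
  (hf.sub ((continuous_polyFun a).continuousOn.div (continuous_polyFun b).continuousOn hb)).abs

theorem abs_sub_le_uniformError {f : ℝ → ℝ} (hf : ContinuousOn f (Set.Icc 0 1)) {m : ℕ}
    (a : Fin (m + 1) → ℝ) {b : Fin (m + 1) → ℝ} (hb : DenomAdmissible b) {x : ℝ}
    (hx : x ∈ Set.Icc (0 : ℝ) 1) :
    |f x - polyFun a x / polyFun b x| ≤ uniformError f a b := by
  have hbdd := isCompact_Icc.bddAbove_image (continuousOn_sub_polyFun_div hf a hb)
  refine le_ciSup (f := fun x : Set.Icc (0 : ℝ) 1 => |f x - polyFun a x / polyFun b x|) ?_ ⟨x, hx⟩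
  rwa [Set.image_eq_range] at hbdd

theorem uniformError_lt {f : ℝ → ℝ} (hf : ContinuousOn f (Set.Icc 0 1)) {m : ℕ}
    (a : Fin (m + 1) → ℝ) {b : Fin (m + 1) → ℝ} (hb : DenomAdmissible b) {E : ℝ}
    (h : ∀ x ∈ Set.Icc (0 : ℝ) 1, |f x - polyFun a x / polyFun b x| < E) :
    uniformError f a b < E := by
  obtain ⟨y, hy, hmax⟩ := isCompact_Icc.exists_isMaxOn (Set.nonempty_Icc.2 zero_le_one)
    (continuousOn_sub_polyFun_div hf a hb)
  have : Nonempty (Set.Icc (0 : ℝ) 1) := ⟨⟨y, hy⟩⟩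
  exact (ciSup_le fun x => hmax x.2).trans_lt (h y hy)

/-- A correction of the same sign pulls the error towards `0`, and is too small to overshoot to `-E`
or `E`. -/
theorem abs_sub_lt_of_mul_nonneg {e δ E : ℝ} (h : 0 ≤ e * δ) (he : |e| ≤ E) (hδ : |δ| < E)
    (h0 : |e| = E → δ ≠ 0) : |e - δ| < E := by
  by_cases heE : |e| = E
  · have hδ0 := h0 heE
    rw [abs_lt]
    rcases lt_or_gt_of_ne hδ0 with hd | hd
    · have he0 : e ≤ 0 := by nlinarith
      rw [abs_of_nonpos he0] at heE
      rw [abs_of_neg hd] at hδ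
      constructor <;> linarith
    · have he0 : 0 ≤ e := by nlinarith
      rw [abs_of_nonneg he0] at heE
      rw [abs_of_pos hd] at hδ
      constructor <;> linarith
  · have he' := lt_of_le_of_ne he heE
    rw [abs_lt] at he' hδ ⊢
    rcases le_total 0 e with h1 | h1
    · rcases h1.eq_or_lt with rfl | h1
      · constructor <;> linarith
      · have : 0 ≤ δ := nonneg_of_mul_nonneg_right h h1
        constructor <;> linarith
    · rcases h1.eq_or_lt with rfl | h1
      · constructor <;> linarith
      · have : δ ≤ 0 := by nlinarith
        constructor <;> linarith

/-- If `p / q` is a best approximation in lowest terms, then its error has at least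
`m + max (deg p) (deg q) + 1` zeros: otherwise a perturbation of `p / q` does better. -/
theorem IsBestRationalApprox.exists_zeros {f : ℝ → ℝ} (hf : ContinuousOn f (Set.Icc 0 1)) {m : ℕ}
    {a b : Fin (m + 1) → ℝ} (hab : IsBestRationalApprox f a b) {p q : ℝ[X]}
    (hpq : IsCoprime p q) (hm : max p.natDegree q.natDegree ≤ m)
    (hq : ∀ x ∈ Set.Icc (0 : ℝ) 1, q.eval x ≠ 0)
    (hr : ∀ x ∈ Set.Icc (0 : ℝ) 1, polyFun a x / polyFun b x = p.eval x / q.eval x) :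
    ∃ Z : Finset ℝ, Z.card = m + max p.natDegree q.natDegree + 1 ∧
      ∀ z ∈ Z, z ∈ Set.Ioo (0 : ℝ) 1 ∧ f z = p.eval z / q.eval z := by
  set N := m + max p.natDegree q.natDegree with hN
  by_contra hcon
  set S := {z : ℝ | z ∈ Set.Ioo (0 : ℝ) 1 ∧ f z = p.eval z / q.eval z} with hS
  have hSfin : S.Finite := by
    by_contra hinf
    obtain ⟨Z, hZ, hc⟩ := Set.Infinite.exists_subset_card_eq hinf (N + 1)
    exact hcon ⟨Z, hc, fun z hz => hZ hz⟩
  set Z := hSfin.toFinset with hZ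
  have hZc : Z.card ≤ N := by
    by_contra hlt
    obtain ⟨T, hT, hc⟩ := Finset.exists_subset_card_eq (show N + 1 ≤ Z.card by lia)
    exact hcon ⟨T, hc, fun z hz => (Set.Finite.mem_toFinset hSfin).1 (hT hz)⟩
  set e : ℝ → ℝ := fun x => f x - p.eval x / q.eval x with he
  have hec : ContinuousOn e (Set.Icc 0 1) :=
    hf.sub (p.continuous.continuousOn.div q.continuous.continuousOn hq)
  obtain ⟨φ, hφd, hφr, hφs⟩ := exists_polynomial_mul_nonneg Z (Set.Ioo 0 1) Set.ordConnected_Ioo e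
    (hec.mono Set.Ioo_subset_Icc_self) (fun x hx h => by
      simpa [hZ, hS] using ⟨hx, sub_eq_zero.1 h⟩) (fun z hz => by
      rw [hZ, Set.Finite.mem_toFinset] at hz
      exact sub_eq_zero.2 hz.2)
  -- Only interior zeros are counted, so the endpoints are reached by continuity.
  have hφs' : ∀ x ∈ Set.Icc (0 : ℝ) 1, 0 ≤ e x * φ.eval x := by
    intro x hx
    have hcl : x ∈ closure (Set.Ioo (0 : ℝ) 1) := by rwa [closure_Ioo zero_ne_one]
    have hc : ContinuousWithinAt (fun x => e x * φ.eval x) (Set.Ioo 0 1) x :=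
      ((hec.mul φ.continuous.continuousOn) x hx).mono Set.Ioo_subset_Icc_self
    have := hc.mem_closure_image hcl
    refine (isClosed_Ici (a := (0 : ℝ))).closure_subset_iff.2 ?_ this
    rintro _ ⟨y, hy, rfl⟩
    exact hφs y hy
  obtain ⟨u, v, hu, hv, huv⟩ := hpq.exists_mul_sub_mul_eq hm (hφd.trans hZc)
  have heE : ∀ x ∈ Set.Icc (0 : ℝ) 1, |e x| ≤ uniformError f a b := fun x hx => by
    have := abs_sub_le_uniformError hf a hab.1 hx
    rwa [hr x hx] at this
  set E := uniformError f a b with hE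
  have hEpos : 0 < E := by
    by_contra hE0
    refine (Set.Ioo_infinite (zero_lt_one (α := ℝ))) (hSfin.subset fun x hx => ⟨hx, ?_⟩)
    have h1 := heE x ⟨hx.1.le, hx.2.le⟩
    exact sub_eq_zero.1 (abs_eq_zero.1 (le_antisymm (h1.trans (not_lt.1 hE0)) (abs_nonneg _)))
  obtain ⟨η, hη, hqη⟩ : ∃ η > 0, ∀ x ∈ Set.Icc (0 : ℝ) 1, η ≤ q.eval x ^ 2 := by
    obtain ⟨y, hy, hmin⟩ := isCompact_Icc.exists_isMinOn (Set.nonempty_Icc.2 zero_le_one)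
      ((q.continuous.pow 2).continuousOn (s := Set.Icc (0 : ℝ) 1))
    exact ⟨q.eval y ^ 2, by have := hq y hy; positivity, fun x hx => hmin hx⟩
  obtain ⟨K, hK⟩ := isCompact_Icc.exists_bound_of_continuousOn
    ((q * v).continuous.continuousOn (s := Set.Icc (0 : ℝ) 1))
  obtain ⟨K', hK'⟩ := isCompact_Icc.exists_bound_of_continuousOn
    (φ.continuous.continuousOn (s := Set.Icc (0 : ℝ) 1))
  -- The first bound keeps `q (q + ε v) ≥ η / 2`, so the new denominator is admissible; the second
  -- keeps the correction below `E`.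
  obtain ⟨ε, hε, hε1, hε2⟩ : ∃ ε > 0, ε * K ≤ η / 2 ∧ ε * K' < E * (η / 2) := by
    have h1 : ∀ᶠ ε : ℝ in nhdsWithin 0 (Set.Ioi 0), ε * K < η / 2 := by
      have : Filter.Tendsto (fun ε : ℝ => ε * K) (nhds 0) (nhds (0 * K)) :=
        (continuous_id.mul continuous_const).tendsto 0
      rw [zero_mul] at this
      exact (this.mono_left nhdsWithin_le_nhds).eventually_lt_const (by positivity)
    have h2 : ∀ᶠ ε : ℝ in nhdsWithin 0 (Set.Ioi 0), ε * K' < E * (η / 2) := by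
      have : Filter.Tendsto (fun ε : ℝ => ε * K') (nhds 0) (nhds (0 * K')) :=
        (continuous_id.mul continuous_const).tendsto 0
      rw [zero_mul] at this
      exact (this.mono_left nhdsWithin_le_nhds).eventually_lt_const (by positivity)
    obtain ⟨ε, ⟨h1, h2⟩, h3⟩ := ((h1.and h2).and self_mem_nhdsWithin).exists
    exact ⟨ε, h3, h1.le, h2⟩
  have hden : ∀ x ∈ Set.Icc (0 : ℝ) 1, η / 2 ≤ q.eval x * (q + C ε * v).eval x := by
    intro x hx
    have h1 := (abs_le.1 (hK x hx)).1
    have h2 := hqη x hx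
    simp only [eval_mul, eval_add, eval_C] at h1 ⊢
    nlinarith
  have hpu : (p + C ε * u).natDegree ≤ m :=
    (natDegree_add_le _ _).trans (max_le (by lia) ((natDegree_C_mul_le _ _).trans hu))
  have hqv : (q + C ε * v).natDegree ≤ m :=
    (natDegree_add_le _ _).trans (max_le (by lia) ((natDegree_C_mul_le _ _).trans hv))
  have hadm : DenomAdmissible fun i : Fin (m + 1) => (q + C ε * v).coeff i := by
    intro x hx h
    rw [polyFun_coeff hqv] at h
    have := hden x hx
    rw [h, mul_zero] at this
    linarith
  refine absurd (hab.2 (fun i => (p + C ε * u).coeff i) _ hadm)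
    (not_le.2 (uniformError_lt hf _ hadm fun x hx => ?_))
  rw [polyFun_coeff hpu, polyFun_coeff hqv]
  have hd := hden x hx
  have hdpos : 0 < q.eval x * (q + C ε * v).eval x := by linarith
  have hqx := hq x hx
  have hqvx : (q + C ε * v).eval x ≠ 0 := right_ne_zero_of_mul hdpos.ne'
  have hδ : f x - (p + C ε * u).eval x / (q + C ε * v).eval x =
      e x - ε * φ.eval x / (q.eval x * (q + C ε * v).eval x) := by
    rw [he, ← huv]
    simp only
    have h3 : (p + C ε * u).eval x / (q + C ε * v).eval x = p.eval x / q.eval x +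
        ε * (u * q - v * p).eval x / (q.eval x * (q + C ε * v).eval x) := by
      field_simp
      simp only [eval_mul, eval_add, eval_C, eval_sub]
      ring
    rw [h3]
    ring
  rw [hδ]
  refine abs_sub_lt_of_mul_nonneg ?_ (heE x hx) ?_ fun h => ?_
  · have := hφs' x hx
    rw [← mul_div_assoc, ← mul_assoc, mul_comm (e x), mul_assoc]
    positivity
  · rw [abs_div, abs_mul, abs_of_pos hdpos, abs_of_pos hε, div_lt_iff₀ hdpos]
    have := hK' x hx
    rw [Real.norm_eq_abs] at this
    calc ε * |φ.eval x| ≤ ε * K' := by gcongr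
      _ < E * (η / 2) := hε2
      _ ≤ _ := by gcongr
  · refine div_ne_zero (mul_ne_zero hε.ne' fun h0 => ?_) hdpos.ne'
    have hxZ := hφr x h0
    rw [hZ, Set.Finite.mem_toFinset] at hxZ
    have : e x = 0 := sub_eq_zero.2 hxZ.2
    rw [this, abs_zero] at h
    exact hEpos.ne h

/-! ### Consequences of interpolating a power at positive nodes -/

theorem Polynomial.degree_lt_of_natDegree_lt {P : ℝ[X]} {n : ℕ} (h : P.natDegree < n) :
    P.degree < n :=
  degree_le_natDegree.trans_lt (by exact_mod_cast h)

section Interpolation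

variable {α : ℝ} {Z : Finset ℝ} {p q : ℝ[X]}

/-- If `p / q` interpolates `x ^ α` at positive nodes, then `q` is orthogonal to the polynomials of
low degree, so `q s` cannot have constant sign on the negative half-line. -/
theorem eq_zero_of_interpolates_rpow (hα : α ∈ Set.Ioo (0 : ℝ) 1) (hZ : ∀ z ∈ Z, 0 < z)
    (hpq : ∀ z ∈ Z, q.eval z * z ^ α = p.eval z) {s : ℝ[X]}
    (hp : p.natDegree + s.natDegree + 1 < Z.card) (hq : q.natDegree + s.natDegree + 1 < Z.card)
    (hs : ∀ t > 0, 0 ≤ q.eval (-t) * s.eval (-t)) : q * s = 0 := by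
  by_contra h0
  -- The factor `X` turns `z ^ (α - 1)` into `z ^ α`; the minus sign makes the polynomial
  -- nonnegative at `-t`.
  have hH : (-(X * (q * s))).natDegree < Z.card := by
    rw [natDegree_neg, natDegree_X_mul h0]
    have := natDegree_mul_le (p := q) (q := s)
    lia
  have hpos := sum_nodalWeight_mul_rpow_pos hα hZ (degree_lt_of_natDegree_lt hH)
    (neg_ne_zero.2 (mul_ne_zero X_ne_zero h0)) (fun t ht => by
      have := mul_nonneg (le_of_lt ht) (hs t ht)
      simpa using this)
  have hG : (p * s).degree + 1 < Z.card := by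
    have h1 : (p * s).natDegree + 1 < Z.card := by
      have := natDegree_mul_le (p := p) (q := s)
      lia
    refine (add_le_add_left degree_le_natDegree 1).trans_lt ?_
    exact_mod_cast h1
  have hzero := sum_nodalWeight_mul_eval_eq_zero hZ hG
  have heq : ∑ z ∈ Z, Lagrange.nodalWeight Z id z * ((-(X * (q * s))).eval z * z ^ (α - 1)) =
      -∑ z ∈ Z, Lagrange.nodalWeight Z id z * (p * s).eval z := by
    rw [← Finset.sum_neg_distrib]
    refine Finset.sum_congr rfl fun z hz => ?_
    rw [eval_mul, ← hpq z hz, Real.rpow_sub_one (hZ z hz).ne']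
    have := (hZ z hz).ne'
    simp only [eval_neg, eval_mul, eval_X]
    field_simp
  rw [heq, hzero] at hpos
  simp at hpos

theorem Finset.prod_sub_neg_of_odd_card {Z : Finset ℝ} (h : Odd Z.card) {y : ℝ}
    (hy : ∀ z ∈ Z, y < z) : ∏ z ∈ Z, (y - z) < 0 := by
  have h1 : ∏ z ∈ Z, (y - z) = (-1) ^ Z.card * ∏ z ∈ Z, (z - y) := by
    rw [← Finset.prod_const, ← Finset.prod_mul_distrib]
    exact Finset.prod_congr rfl fun z _ => by ring
  rw [h1, h.neg_one_pow]
  have : 0 < ∏ z ∈ Z, (z - y) := Finset.prod_pos fun z hz => sub_pos.2 (hy z hz)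
  linarith

/-- If `X q s = (X - y) H` with `y ≤ 0` and `H` nonnegative on the negative half-line, then `p s`
is positive at `y`. -/
theorem sign_of_interpolates_rpow (hα : α ∈ Set.Ioo (0 : ℝ) 1) (hZ : ∀ z ∈ Z, 0 < z)
    (hodd : Odd Z.card) (hpq : ∀ z ∈ Z, q.eval z * z ^ α = p.eval z) {s H : ℝ[X]} {y : ℝ}
    (hy : y ≤ 0) (hps : p.natDegree + s.natDegree < Z.card) (hH : H.natDegree < Z.card)
    (hH0 : H ≠ 0) (hHpos : ∀ t > 0, 0 ≤ H.eval (-t)) (hHs : (X - C y) * H = X * (q * s)) :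
    0 < p.eval y * s.eval y := by
  have hpos := sum_nodalWeight_mul_rpow_pos hα hZ (degree_lt_of_natDegree_lt hH) hH0 hHpos
  rw [(hodd.add_one).neg_one_pow, one_mul] at hpos
  have hyz : ∀ z ∈ Z, y < z := fun z hz => hy.trans_lt (hZ z hz)
  have hsum := sum_nodalWeight_mul_eval_div_sub (Z := Z) (G := p * s) (y := y)
    (degree_lt_of_natDegree_lt (natDegree_mul_le.trans_lt hps)) (fun z hz => (hyz z hz).ne)
  -- At a node, `H z * z ^ (α - 1) = p z * s z / (z - y)`, so partial fractions isolate `p y * s y`.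
  have heq : ∑ z ∈ Z, Lagrange.nodalWeight Z id z * (H.eval z * z ^ (α - 1)) =
      -∑ z ∈ Z, Lagrange.nodalWeight Z id z * ((p * s).eval z / (y - z)) := by
    rw [← Finset.sum_neg_distrib]
    refine Finset.sum_congr rfl fun z hz => ?_
    have h1 := congrArg (Polynomial.eval z) hHs
    simp only [eval_mul, eval_sub, eval_X, eval_C] at h1
    have h2 : z - y ≠ 0 := (sub_pos.2 (hyz z hz)).ne'
    have h3 : y - z ≠ 0 := (sub_neg.2 (hyz z hz)).ne
    have h4 := (hZ z hz).ne'
    have h5 : H.eval z = z * (q.eval z * s.eval z) / (z - y) := by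
      rw [eq_div_iff h2, ← h1, mul_comm]
    rw [eval_mul, ← hpq z hz, Real.rpow_sub_one h4, h5]
    rw [show y - z = -(z - y) by ring]
    field_simp
  rw [heq, hsum, eval_mul] at hpos
  have hW := Finset.prod_sub_neg_of_odd_card hodd hyz
  by_contra hneg
  have := div_nonneg_of_nonpos (not_lt.1 hneg) hW.le
  linarith

/-- The classical argument for zeros of orthogonal polynomials: with fewer than `m` negative zeros,
a `φ` of degree below `m` matches the sign of `q` on the negative half-line, against orthogonality.
-/
theorem exists_negative_roots (hα : α ∈ Set.Ioo (0 : ℝ) 1) (hZ : ∀ z ∈ Z, 0 < z)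
    (hpq : ∀ z ∈ Z, q.eval z * z ^ α = p.eval z) (hq0 : q ≠ 0) {m : ℕ} (hp : p.natDegree ≤ m)
    (hq : q.natDegree ≤ m) (hc : Z.card = 2 * m + 1) :
    ∃ R : Finset ℝ, R.card = m ∧ ∀ ξ ∈ R, ξ < 0 ∧ q.eval ξ = 0 := by
  set R := q.roots.toFinset.filter (· < 0) with hR
  have hmem : ∀ x, x ∈ R ↔ x < 0 ∧ q.eval x = 0 := fun x => by
    simp [hR, hq0, and_comm]
  have hRm : R.card ≤ m := ((Finset.card_filter_le _ _).trans (Multiset.toFinset_card_le _)).trans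
    ((card_roots' q).trans hq)
  refine ⟨R, le_antisymm hRm ?_, fun ξ hξ => (hmem ξ).1 hξ⟩
  by_contra hlt
  obtain ⟨φ, hφd, hφr, hφs⟩ := exists_polynomial_mul_nonneg R (Set.Iio 0) Set.ordConnected_Iio
    (fun x => q.eval x) q.continuous.continuousOn (fun x hx h => (hmem x).2 ⟨hx, h⟩)
    (fun z hz => ((hmem z).1 hz).2)
  have h := eq_zero_of_interpolates_rpow hα hZ hpq (s := φ) (by lia) (by lia)
    (fun t ht => hφs (-t) (neg_lt_zero.2 ht))
  rcases mul_eq_zero.1 h with h | h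
  · exact hq0 h
  · have := ((hmem 0).1 (hφr 0 (by simp [h]))).1
    exact lt_irrefl _ this

theorem residue_neg (hα : α ∈ Set.Ioo (0 : ℝ) 1) (hZ : ∀ z ∈ Z, 0 < z)
    (hpq : ∀ z ∈ Z, q.eval z * z ^ α = p.eval z) (hq0 : q ≠ 0) {m : ℕ} (hp : p.natDegree ≤ m)
    (hq : q.natDegree ≤ m) (hc : Z.card = 2 * m + 1) {ξ : ℝ} (hξ : ξ < 0) (hqξ : q.eval ξ = 0) :
    p.eval ξ * q.derivative.eval ξ < 0 := by
  obtain ⟨s, rfl⟩ := dvd_iff_isRoot.2 hqξ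
  have hs0 : s ≠ 0 := right_ne_zero_of_mul hq0
  have hdeg : s.natDegree + 1 ≤ m := by
    rwa [natDegree_mul (X_sub_C_ne_zero ξ) hs0, natDegree_X_sub_C, add_comm] at hq
  have hd : (derivative ((X - C ξ) * s)).eval ξ = s.eval ξ := by simp
  have hs2 := natDegree_mul_le (p := s) (q := s)
  -- With `q = (X - ξ) s`, testing against `-s` gives `H = -X s ^ 2`, nonnegative on the negative
  -- half-line, and `s ξ` is the derivative of `q` at `ξ`.
  have h := sign_of_interpolates_rpow hα hZ (hc ▸ odd_two_mul_add_one m) hpq (s := -s)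
    (H := -(X * (s * s))) hξ.le (by rw [natDegree_neg]; lia)
    (by rw [natDegree_neg, natDegree_X_mul (mul_ne_zero hs0 hs0)]; lia)
    (neg_ne_zero.2 (mul_ne_zero X_ne_zero (mul_ne_zero hs0 hs0)))
    (fun t ht => by
      have := mul_nonneg (le_of_lt ht) (mul_self_nonneg (s.eval (-t)))
      simpa using this) (by ring)
  rw [eval_neg] at h
  rw [hd]
  linarith

theorem mul_pos_at_zero (hα : α ∈ Set.Ioo (0 : ℝ) 1) (hZ : ∀ z ∈ Z, 0 < z)
    (hpq : ∀ z ∈ Z, q.eval z * z ^ α = p.eval z) (hq0 : q ≠ 0) {m : ℕ} (hp : p.natDegree ≤ m)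
    (hq : q.natDegree ≤ m) (hc : Z.card = 2 * m + 1) : 0 < p.eval 0 * q.eval 0 := by
  have hq2 := natDegree_mul_le (p := q) (q := q)
  exact sign_of_interpolates_rpow hα hZ (hc ▸ odd_two_mul_add_one m) hpq (H := q * q) le_rfl
    (by lia) (by lia) (mul_ne_zero hq0 hq0)
    (fun t _ => by rw [eval_mul]; exact mul_self_nonneg _) (by simp)

end Interpolation

/-! ### Nondegeneracy of best approximations -/

theorem natDegree_sum_C_mul_X_pow_le {m : ℕ} (a : Fin (m + 1) → ℝ) :
    (∑ i : Fin (m + 1), C (a i) * X ^ (i : ℕ)).natDegree ≤ m :=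
  natDegree_sum_le_of_forall_le _ _ fun i _ =>
    (natDegree_C_mul_X_pow_le _ _).trans (Nat.lt_succ_iff.1 i.2)

theorem eval_sum_C_mul_X_pow {m : ℕ} (a : Fin (m + 1) → ℝ) (x : ℝ) :
    (∑ i : Fin (m + 1), C (a i) * X ^ (i : ℕ)).eval x = polyFun a x := by
  simp [polyFun, eval_finsetSum]

/-- The error of a best approximation to `x ^ α` has `2 m + 1` zeros; in particular a best
approximation is not degenerate. -/
theorem IsBestRationalApprox.exists_zeros_rpow {α : ℝ} (hα : α ∈ Set.Ioo (0 : ℝ) 1) {m : ℕ}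
    {a b : Fin (m + 1) → ℝ} (hab : IsBestRationalApprox (fun x : ℝ => x ^ α) a b) :
    ∃ Z : Finset ℝ, Z.card = 2 * m + 1 ∧
      ∀ z ∈ Z, 0 < z ∧ polyFun b z * z ^ α = polyFun a z := by
  set P := ∑ i : Fin (m + 1), C (a i) * X ^ (i : ℕ) with hP
  set Q := ∑ i : Fin (m + 1), C (b i) * X ^ (i : ℕ) with hQ
  have hPe : ∀ x, P.eval x = polyFun a x := eval_sum_C_mul_X_pow a
  have hQe : ∀ x, Q.eval x = polyFun b x := eval_sum_C_mul_X_pow b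
  have hPd : P.natDegree ≤ m := natDegree_sum_C_mul_X_pow_le a
  have hQd : Q.natDegree ≤ m := natDegree_sum_C_mul_X_pow_le b
  have hQ0 : Q ≠ 0 := by
    intro h
    refine hab.1 0 (by simp) ?_
    rw [← hQe, h, eval_zero]
  obtain ⟨g, p, q, hgp, hgq, hcop⟩ : ∃ g p q : ℝ[X], P = g * p ∧ Q = g * q ∧ IsCoprime p q := by
    let _ : GCDMonoid ℝ[X] := EuclideanDomain.gcdMonoid ℝ[X]
    have hg := gcd_ne_zero_of_right (a := P) hQ0
    exact ⟨gcd P Q, P / gcd P Q, Q / gcd P Q,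
      (EuclideanDomain.mul_div_cancel' hg (gcd_dvd_left _ _)).symm,
      (EuclideanDomain.mul_div_cancel' hg (gcd_dvd_right _ _)).symm,
      isCoprime_div_gcd_div_gcd hQ0⟩
  have hg0 : g ≠ 0 := by rintro rfl; exact hQ0 (by simp [hgq])
  have hq0 : q ≠ 0 := by rintro rfl; exact hQ0 (by simp [hgq])
  have hle : ∀ {A B : ℝ[X]}, A = g * B → A.natDegree ≤ m → B.natDegree ≤ m := by
    intro A B h hA
    by_cases hB : B = 0
    · simp [hB]
    · rw [h, natDegree_mul hg0 hB] at hA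
      lia
  have hpd := hle hgp hPd
  have hqd := hle hgq hQd
  have hQx : ∀ x ∈ Set.Icc (0 : ℝ) 1, g.eval x ≠ 0 ∧ q.eval x ≠ 0 := by
    intro x hx
    have := hab.1 x hx
    rw [← hQe, hgq, eval_mul] at this
    exact mul_ne_zero_iff.1 this
  have hf : ContinuousOn (fun x : ℝ => x ^ α) (Set.Icc 0 1) :=
    (Real.continuous_rpow_const hα.1.le).continuousOn
  obtain ⟨Z, hZc, hZ⟩ := hab.exists_zeros hf hcop (max_le hpd hqd) (fun x hx => (hQx x hx).2)
    (fun x hx => by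
      rw [← hPe, ← hQe, hgp, hgq, eval_mul, eval_mul, mul_div_mul_left _ _ (hQx x hx).1])
  have hZpos : ∀ z ∈ Z, 0 < z := fun z hz => (hZ z hz).1.1
  have hZpq : ∀ z ∈ Z, q.eval z * z ^ α = p.eval z := fun z hz => by
    have h1 := (hQx z ⟨(hZ z hz).1.1.le, (hZ z hz).1.2.le⟩).2
    have h2 := (hZ z hz).2
    rw [h2, mul_div_cancel₀ _ h1]
  -- If both degrees were below `m`, there would be enough nodes to test `q` against itself, forcing
  -- `q * q = 0`.
  have hmax : max p.natDegree q.natDegree = m := by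
    by_contra hne
    have hcard : 2 * max p.natDegree q.natDegree + 2 ≤ Z.card := by
      have := max_le hpd hqd
      lia
    have := eq_zero_of_interpolates_rpow hα hZpos hZpq (s := q) (by lia) (by lia)
      (fun t _ => mul_self_nonneg _)
    exact hq0 (mul_self_eq_zero.1 this)
  refine ⟨Z, by lia, fun z hz => ⟨hZpos z hz, ?_⟩⟩
  rw [← hPe, ← hQe, hgp, hgq, eval_mul, eval_mul, ← hZpq z hz]
  ring

/-! ### Reversed polynomials and the partial fraction expansion -/

theorem natDegree_sum_C_mul_X_pow_sub_le {m : ℕ} (a : Fin (m + 1) → ℝ) :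
    (∑ i : Fin (m + 1), C (a i) * X ^ (m - (i : ℕ))).natDegree ≤ m :=
  natDegree_sum_le_of_forall_le _ _ fun _ _ =>
    (natDegree_C_mul_X_pow_le _ _).trans (Nat.sub_le _ _)

theorem eval_sum_C_mul_X_pow_sub {m : ℕ} (a : Fin (m + 1) → ℝ) (x : ℝ) :
    (∑ i : Fin (m + 1), C (a i) * X ^ (m - (i : ℕ))).eval x = revPolyFun a x := by
  simp [revPolyFun, eval_finsetSum]

theorem coeff_sum_C_mul_X_pow_sub {m : ℕ} (a : Fin (m + 1) → ℝ) :
    (∑ i : Fin (m + 1), C (a i) * X ^ (m - (i : ℕ))).coeff m = a 0 := by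
  rw [finsetSum_coeff, Finset.sum_eq_single 0]
  · simp
  · intro i _ hi
    have : (i : ℕ) ≠ 0 := fun h => hi (Fin.ext h)
    rw [coeff_C_mul_X_pow, if_neg (by lia)]
  · simp

theorem polyFun_zero {m : ℕ} (a : Fin (m + 1) → ℝ) : polyFun a 0 = a 0 := by
  rw [polyFun, Fin.sum_univ_succ]
  simp

theorem revPolyFun_eq {m : ℕ} (a : Fin (m + 1) → ℝ) {x : ℝ} (hx : x ≠ 0) :
    revPolyFun a x = x ^ m * polyFun a x⁻¹ := by
  rw [revPolyFun, polyFun, Finset.mul_sum]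
  refine Finset.sum_congr rfl fun i _ => ?_
  rw [pow_sub₀ x hx (Nat.lt_succ_iff.1 i.2), inv_pow]
  ring

theorem Polynomial.degree_lt_of_coeff_eq_zero {P : ℝ[X]} {m : ℕ} (h : P.natDegree ≤ m)
    (h0 : P.coeff m = 0) : P.degree < m := by
  rw [degree_lt_iff_coeff_zero]
  intro k hk
  rcases hk.eq_or_lt with rfl | hk
  · exact h0
  · exact coeff_eq_zero_of_natDegree_lt (h.trans_lt hk)

theorem proposition1 (α : ℝ) (hα : α ∈ Set.Ioo (0 : ℝ) 1) (m : ℕ)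
    (a b : Fin (m + 1) → ℝ)
    (hab : IsBestRationalApprox (fun x : ℝ => x ^ α) a b) :
    ∃ (k : ℝ) (c p : Fin m → ℝ),
      0 < k ∧ (∀ i, 0 < c i) ∧ (∀ i, p i < 0) ∧ Function.Injective p ∧
      (∀ x : ℝ, revPolyFun b x = 0 ↔ ∃ i, x = p i) ∧
      ∀ x : ℝ, revPolyFun b x ≠ 0 →
        revPolyFun a x / revPolyFun b x = k + ∑ i, c i / (x - p i) := by
  set P := ∑ i : Fin (m + 1), C (a i) * X ^ (i : ℕ)
  set Q := ∑ i : Fin (m + 1), C (b i) * X ^ (i : ℕ)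
  have hPe : ∀ x, P.eval x = polyFun a x := eval_sum_C_mul_X_pow a
  have hQe : ∀ x, Q.eval x = polyFun b x := eval_sum_C_mul_X_pow b
  have hPd : P.natDegree ≤ m := natDegree_sum_C_mul_X_pow_le a
  have hQd : Q.natDegree ≤ m := natDegree_sum_C_mul_X_pow_le b
  have hb0 : b 0 ≠ 0 := polyFun_zero b ▸ hab.1 0 (by simp)
  have hQ0 : Q ≠ 0 := by
    intro h
    rw [← polyFun_zero b, ← hQe, h, eval_zero] at hb0
    exact hb0 rfl
  obtain ⟨Z, hZc, hZ⟩ := hab.exists_zeros_rpow hα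
  have hZpos : ∀ z ∈ Z, 0 < z := fun z hz => (hZ z hz).1
  have hZPQ : ∀ z ∈ Z, Q.eval z * z ^ α = P.eval z := fun z hz => by
    rw [hPe, hQe]
    exact (hZ z hz).2
  obtain ⟨R, hRc, hR⟩ := exists_negative_roots hα hZpos hZPQ hQ0 hPd hQd hZc
  have hab0 : 0 < a 0 * b 0 := by
    have := mul_pos_at_zero hα hZpos hZPQ hQ0 hPd hQd hZc
    rwa [hPe, hQe, polyFun_zero, polyFun_zero] at this
  set p : Fin m → ℝ := fun i => (R.orderEmbOfFin hRc i)⁻¹ with hp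
  have hpR : ∀ i, (p i)⁻¹ < 0 ∧ Q.eval (p i)⁻¹ = 0 := fun i => by
    rw [hp, inv_inv]
    exact hR _ (R.orderEmbOfFin_mem hRc i)
  have hpneg : ∀ i, p i < 0 := fun i => inv_lt_zero.1 (hpR i).1
  have hpinj : Function.Injective p := fun i j h =>
    (R.orderEmbOfFin hRc).injective (inv_injective h)
  set A := ∑ i : Fin (m + 1), C (a i) * X ^ (m - (i : ℕ))
  set B := ∑ i : Fin (m + 1), C (b i) * X ^ (m - (i : ℕ))
  have hAe : ∀ x, A.eval x = revPolyFun a x := eval_sum_C_mul_X_pow_sub a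
  have hBe : ∀ x, B.eval x = revPolyFun b x := eval_sum_C_mul_X_pow_sub b
  have hAd : A.natDegree ≤ m := natDegree_sum_C_mul_X_pow_sub_le a
  have hBd : B.natDegree ≤ m := natDegree_sum_C_mul_X_pow_sub_le b
  have hBp : ∀ i, B.eval (p i) = 0 := fun i => by
    rw [hBe, revPolyFun_eq b (hpneg i).ne, ← hQe, (hpR i).2, mul_zero]
  set W := Lagrange.nodal Finset.univ p with hW
  have hWd : W.natDegree = m := by rw [hW, Lagrange.natDegree_nodal]; simp
  have hWc : W.coeff m = 1 := by
    have := (Lagrange.nodal_monic (s := Finset.univ) (v := p)).coeff_natDegree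
    rwa [← hW, hWd] at this
  have hBW : B = C (b 0) * W := by
    rw [← sub_eq_zero]
    refine eq_zero_of_degree_lt_of_eval_index_eq_zero Finset.univ hpinj.injOn
      ?_ fun i _ => ?_
    · rw [Finset.card_univ, Fintype.card_fin]
      refine degree_lt_of_coeff_eq_zero ((natDegree_sub_le _ _).trans (max_le hBd ?_)) ?_
      · exact (natDegree_C_mul_le _ _).trans hWd.le
      · rw [coeff_sub, coeff_C_mul, hWc, coeff_sum_C_mul_X_pow_sub, mul_one, sub_self]
    · rw [eval_sub, eval_mul, hBp, hW, Lagrange.eval_nodal_at_node (Finset.mem_univ i)]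
      simp
  have hBroot : ∀ x, revPolyFun b x = 0 ↔ ∃ i, x = p i := fun x => by
    rw [← hBe, hBW, eval_mul, eval_C, mul_eq_zero, or_iff_right hb0, hW, Lagrange.eval_nodal,
      Finset.prod_eq_zero_iff]
    simp [sub_eq_zero]
  set k := a 0 / b 0 with hk
  have hk0 : 0 < k := by
    rw [hk, ← mul_div_mul_right _ _ hb0]
    exact div_pos hab0 (mul_self_pos.2 hb0)
  -- The derivative of `x⁻¹` is negative, so reversal flips the sign supplied by `residue_neg`.
  have hsign : ∀ i, 0 < A.eval (p i) * B.derivative.eval (p i) := fun i => by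
    have hpi := (hpneg i).ne
    have h1 : HasDerivAt (fun x => x ^ m * Q.eval x⁻¹)
        (m * p i ^ (m - 1) * Q.eval (p i)⁻¹ +
          p i ^ m * (Q.derivative.eval (p i)⁻¹ * -(p i ^ 2)⁻¹)) (p i) :=
      (hasDerivAt_pow m (p i)).mul ((Q.hasDerivAt (p i)⁻¹).comp (p i) (hasDerivAt_inv hpi))
    have h2 : HasDerivAt (fun x => B.eval x) _ (p i) := h1.congr_of_eventuallyEq <| by
      filter_upwards [isOpen_ne.mem_nhds hpi] with x hx
      rw [hBe, revPolyFun_eq b hx, hQe]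
    have h3 := (B.hasDerivAt (p i)).unique h2
    have h4 := residue_neg hα hZpos hZPQ hQ0 hPd hQd hZc (hpR i).1 (hpR i).2
    rw [h3, (hpR i).2, hAe, revPolyFun_eq a hpi, ← hPe]
    have h5 : p i ^ m * P.eval (p i)⁻¹ * (m * p i ^ (m - 1) * 0 +
        p i ^ m * (Q.derivative.eval (p i)⁻¹ * -(p i ^ 2)⁻¹)) =
        (p i ^ m) ^ 2 * (p i ^ 2)⁻¹ * -(P.eval (p i)⁻¹ * Q.derivative.eval (p i)⁻¹) := by ring
    rw [h5]
    have h6 := pow_ne_zero m hpi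
    have := neg_pos.2 h4
    positivity
  -- The coefficients are the residues `A (p i) / B' (p i)`, since `B = b 0 * W` and the nodal
  -- weight is `1 / W' (p i)`.
  refine ⟨k, fun i => Lagrange.nodalWeight Finset.univ p i * A.eval (p i) / b 0, p, hk0,
    fun i => ?_, hpneg, hpinj, hBroot, fun x hx => ?_⟩
  · have h := hsign i
    beta_reduce
    rw [Lagrange.nodalWeight_eq_eval_derivative_nodal (Finset.mem_univ i), ← hW]
    rw [hBW, derivative_C_mul, eval_mul, eval_C] at h
    have hne : b 0 * W.derivative.eval (p i) ≠ 0 := right_ne_zero_of_mul h.ne'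
    have h' := div_pos h (mul_self_pos.2 hne)
    rw [mul_div_mul_right _ _ hne] at h'
    rwa [mul_comm, ← div_eq_mul_inv, div_div, mul_comm (W.derivative.eval (p i))]
  · have hxp : ∀ i ∈ Finset.univ, x ≠ p i := fun i _ h => hx ((hBroot x).2 ⟨i, h⟩)
    -- Subtracting `k B` cancels the coefficient of `X ^ m`, so Lagrange interpolation at the `m`
    -- poles is exact.
    have hD : (A - C k * B).degree < (Finset.univ : Finset (Fin m)).card := by
      rw [Finset.card_univ, Fintype.card_fin]
      refine degree_lt_of_coeff_eq_zero ((natDegree_sub_le _ _).trans (max_le hAd ?_)) ?_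
      · exact (natDegree_C_mul_le _ _).trans hBd
      · rw [coeff_sub, coeff_C_mul, coeff_sum_C_mul_X_pow_sub, coeff_sum_C_mul_X_pow_sub, hk,
          div_mul_cancel₀ _ hb0, sub_self]
    have h1 := congrArg (Polynomial.eval x) (Lagrange.eq_interpolate hpinj.injOn hD)
    rw [Lagrange.eval_interpolate_not_at_node _ hxp, ← hW] at h1
    simp only [eval_sub, eval_mul, eval_C, hBp, mul_zero, sub_zero] at h1
    rw [← hBe] at hx
    have hBx : B.eval x = b 0 * W.eval x := by rw [hBW, eval_mul, eval_C]
    have hWx : W.eval x ≠ 0 := right_ne_zero_of_mul (hBx ▸ hx)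
    rw [← hAe, ← hBe, div_eq_iff hx, add_mul, ← sub_eq_iff_eq_add', h1, hBx, Finset.mul_sum,
      Finset.sum_mul]
    refine Finset.sum_congr rfl fun i hi => ?_
    have := sub_ne_zero.2 (hxp i hi)
    field_simp
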